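/- For $n\ge 0$ let $E_n(x)$ be the $n$-th Euler polynomial, defined by $\frac{2e^{xz}}{e^z+1}=\sum_{n\ge0}E_n(x)\frac{z^n}{n!}$; let $\left(\frac{\cdot}{p}\right)$ be the Legendre symbol and $\lfloor\cdot\rfloor$ the floor function. Congruences modulo $p^2$ are taken in the ring $\mathbb{Z}_p$ of $p$-adic integers; in particular, both sides lie in $\mathbb{Z}_p$. Let $p$ be an odd prime. Then $$\sum_{k=0}^{p-1}\frac{\binom{4k}{2k}}{32^k}\equiv \frac{3}{32}\,p\left(E_{p-2}\left(\tfrac38\right)+E_{p-2}\left(\tfrac18\right)\right)+\begin{cases}\left(\frac{-2}{p}\right)(-1)^{\lfloor p/8\rfloor}, & \text{if } p\equiv\pm1\pmod 8,\\[2pt] \frac12\left(\frac{-2}{p}\right)(-1)^{\lfloor p/8\rfloor}, & \text{if } p\equiv\pm3\pmod 8,\end{cases}\pmod{p^2}.$$ Moreover, if $p>3$, then $$\sum_{k=0}^{p-1}\binom{3k}{k}\left(\frac{2}{27}\right)^k\equiv\frac13+\frac23\left(\frac{3}{p}\right)+\frac p9\left(E_{p-2}\left(\tfrac13\right)+E_{p-2}\left(\tfrac16\right)\right)\pmod{p^2}$$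 and $$\sum_{k=0}^{p-1}\frac{\binom{6k}{3k}\binom{3k}{k}}{216^k\binom{2k}{k}}\equiv\left(\frac{6}{p}\right)+\frac{5p}{72}\left(E_{p-2}\left(\tfrac5{12}\right)+E_{p-2}\left(\tfrac1{12}\right)\right)\pmod{p^2}.$$ -/

import Mathlib

/-- The value `E_n(x)` of the `n`-th Euler polynomial at a rational number `x`, defined by the
(formal) generating function `2 e^(x z) / (e^z + 1) = ∑ E_n(x) z^n / n!`: it is `n!` times the
coefficient of `z^n` of the left-hand side, an element of `ℚ⟦z⟧`. -/
noncomputable def eulerPoly (n : ℕ) (x : ℚ) : ℚ :=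
  (n.factorial : ℚ) *
    PowerSeries.coeff n
      (2 * PowerSeries.rescale x (PowerSeries.exp ℚ) * (PowerSeries.exp ℚ + 1)⁻¹)

/-- The division by `e^z + 1` in the definition of `eulerPoly` is a genuine one. -/
theorem eulerPoly_generating_function (x : ℚ) :
    PowerSeries.mk (fun n => eulerPoly n x / (n.factorial : ℚ)) * (PowerSeries.exp ℚ + 1) =
      2 * PowerSeries.rescale x (PowerSeries.exp ℚ) := by
  have h : PowerSeries.mk (fun n => eulerPoly n x / (n.factorial : ℚ)) =
      2 * PowerSeries.rescale x (PowerSeries.exp ℚ) * (PowerSeries.exp ℚ + 1)⁻¹ := by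
    ext n
    rw [PowerSeries.coeff_mk, eulerPoly,
      mul_div_cancel_left₀ _ (Nat.cast_ne_zero.mpr n.factorial_ne_zero)]
  rw [h, mul_assoc, PowerSeries.inv_mul_cancel, mul_one]
  simp only [map_add, map_one, PowerSeries.constantCoeff_exp]
  norm_num

/-- `a ≡ b (mod p ^ m)` for rational numbers `a`, `b`, as a congruence in the ring of `p`-adic
integers: both `a` and `b` are `p`-adic integers, and `p ^ m` divides their difference there. -/
def PadicModEq (p : ℕ) [Fact p.Prime] (m : ℕ) (a b : ℚ) : Prop :=
  ∃ u v : ℤ_[p], (u : ℚ_[p]) = (a : ℚ_[p]) ∧ (v : ℚ_[p]) = (b : ℚ_[p]) ∧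
    (p : ℤ_[p]) ^ m ∣ u - v

/-! ### The sum over `k` of C(x + k, 2k) (-2)^k in a binomial ring. -/

section BinomialSum

variable {R : Type*} [CommRing R] [BinomialRing R]

/-! Let S(x) be the sum of C(x + k, 2k) (-2)^k over k < p. Comparing ratios of consecutive terms,
the three sums are S(-1/4), S(-1/3) and S(-1/6). Two symmetries govern S: S(-1 - x) = S(x), and S(x
+ 1) + S(x - 1) is one boundary term, a power of 2 times a binomial coefficient. The boundary term
vanishes at small integers, so S(n) is a sign of period four for 0 ≤ n < p (`binomSum_natCast`).

Write x = n + p t with t in ℤ_p. Since p divides (2k)! at most once for k < p, S(n + p t) is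
quadratic in t modulo p^2, hence determined by its values at t = 0, 1, -1
(`binomSum_interpolation`). Those at 0 and -1 are signs. The value S(n + p) follows from the
recurrence, whose boundary term now contributes: the correction is p k, where k modulo p is
-(G(-n/2) + G((n+1)/2)) and G(y) is the alternating sum `altPowSum`, with G(y + 1) + G(y) = 2/y
(`binomSum_add_prime_eq`).

The polynomial E_{p-2} has p-integral coefficients and satisfies the same difference equation, so
E_{p-2} ≡ G modulo p (`exists_padicInt_eulerPoly`). In every case t is x or -1 - x, so t(t + 1) =
x(x + 1), the constant in front of the Euler polynomials. The remaining weighted signs are Legendre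
symbols. -/

theorem factorial_mul_ringChoose (r : R) (m : ℕ) :
    (m.factorial : R) * Ring.choose r m = ∏ i ∈ Finset.range m, (r - i) := by
  rw [← nsmul_eq_mul, ← Ring.descPochhammer_eq_factorial_smul_choose]
  induction m with
  | zero => simp
  | succ m ih =>
    rw [descPochhammer_succ_right, Polynomial.smeval_mul, ih, Finset.prod_range_succ]
    simp [Polynomial.smeval_sub, Polynomial.smeval_X, Polynomial.smeval_natCast]

theorem ringChoose_ext {r s : R} {m : ℕ}
    (h : ∏ i ∈ Finset.range m, (r - i) = ∏ i ∈ Finset.range m, (s - i)) :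
    Ring.choose r m = Ring.choose s m := by
  have := BinomialRing.toIsAddTorsionFree (R := R)
  rw [← nsmul_right_inj (Nat.factorial_ne_zero m), nsmul_eq_mul, nsmul_eq_mul,
    factorial_mul_ringChoose, factorial_mul_ringChoose, h]

/-- The 2k factors x + k, ..., x - k + 1 are permuted up to sign by x ↦ -1 - x, and the number of
signs is even. -/
theorem ringChoose_reflect (x : R) (k : ℕ) :
    Ring.choose (-1 - x + k) (2 * k) = Ring.choose (x + k) (2 * k) := by
  apply ringChoose_ext
  rw [← Finset.prod_range_reflect]
  have h : ∀ i ∈ Finset.range (2 * k), -1 - x + (k : R) - ((2 * k - 1 - i : ℕ) : R) =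
      (-1) * (x + k - i) := by
    intro i hi
    rw [Finset.mem_range] at hi
    rw [show 2 * k - 1 - i = 2 * k - (1 + i) by omega, Nat.cast_sub (by omega)]
    push_cast
    ring
  rw [Finset.prod_congr rfl h, Finset.prod_mul_distrib]
  simp

theorem ringChoose_second_difference (x : R) (k : ℕ) :
    Ring.choose (x + 1 + (k + 1)) (2 * k + 2) + Ring.choose (x - 1 + (k + 1)) (2 * k + 2)
      = 2 * Ring.choose (x + (k + 1)) (2 * k + 2) + Ring.choose (x + k) (2 * k) := by
  have h1 := Ring.choose_succ_succ (x + (k + 1)) (2 * k + 1)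
  have h2 := Ring.choose_succ_succ (x + k) (2 * k + 1)
  have h3 := Ring.choose_succ_succ (x + k) (2 * k)
  rw [show x + 1 + ((k : R) + 1) = x + (k + 1) + 1 by ring,
    show x - 1 + ((k : R) + 1) = x + k by ring]
  rw [show x + (k : R) + 1 = x + (k + 1) by ring] at h2 h3
  linear_combination h1 - h2 + h3

/-- The truncated sum `∑_{k < N} C(x + k, 2k) (-2)^k`. -/
noncomputable def binomSum (N : ℕ) (x : R) : R :=
  ∑ k ∈ Finset.range N, Ring.choose (x + k) (2 * k) * (-2) ^ k

theorem binomSum_reflect (N : ℕ) (x : R) : binomSum N (-1 - x) = binomSum N x := by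
  simp only [binomSum, ringChoose_reflect]

/-- The second difference in x lowers k by one, so the weight -2 cancels the term 2 S(x) except at
the top index. -/
theorem binomSum_add_one_add_sub_one (N : ℕ) (x : R) :
    binomSum (N + 1) (x + 1) + binomSum (N + 1) (x - 1)
      = -(-2) ^ (N + 1) * Ring.choose (x + N) (2 * N) := by
  induction N with
  | zero => simp [binomSum]; norm_num
  | succ N ih =>
    rw [binomSum, binomSum, Finset.sum_range_succ, Finset.sum_range_succ _ (N + 1)]
    rw [binomSum, binomSum] at ih
    have h := ringChoose_second_difference x N
    rw [show 2 * (N + 1) = 2 * N + 2 by ring]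
    push_cast
    linear_combination ih + (-2) ^ (N + 1) * h

/-- The sequence `1, -1, -1, 1, ...` of period four. -/
def altSign (n : ℕ) : ℤ := (-1) ^ ((n + 1) / 2)

theorem altSign_zero : altSign 0 = 1 := rfl

theorem altSign_one : altSign 1 = -1 := rfl

theorem altSign_add_two (n : ℕ) : altSign (n + 2) = -altSign n := by
  rw [altSign, altSign, show (n + 2 + 1) / 2 = (n + 1) / 2 + 1 by omega, pow_succ]
  ring

theorem altSign_two_mul (n : ℕ) : altSign (2 * n) = (-1) ^ n := by
  rw [altSign]
  congr 1
  omega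

theorem altSign_two_mul_add_one (n : ℕ) : altSign (2 * n + 1) = (-1) ^ (n + 1) := by
  rw [altSign]
  congr 1
  omega

theorem binomSum_zero (N : ℕ) : binomSum (N + 1) (0 : R) = 1 := by
  rw [binomSum, Finset.sum_range_succ', Finset.sum_eq_zero]
  · simp
  · intro k _
    rw [zero_add, Ring.choose_natCast, Nat.choose_eq_zero_of_lt (by omega)]
    simp

theorem binomSum_natCast {N : ℕ} (n : ℕ) (hn : n < N) :
    binomSum N (n : R) = (altSign n : R) := by
  obtain ⟨N, rfl⟩ : ∃ M, N = M + 1 := ⟨N - 1, by omega⟩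
  induction n using Nat.strong_induction_on with
  | _ n ih =>
    match n, hn, ih with
    | 0, _, _ => simp [binomSum_zero, altSign_zero]
    | 1, hn, _ =>
      have h := binomSum_add_one_add_sub_one N (0 : R)
      rw [zero_add, zero_sub, show (-1 : R) = -1 - 0 by ring, binomSum_reflect, binomSum_zero,
        zero_add, Ring.choose_natCast, Nat.choose_eq_zero_of_lt (by omega)] at h
      simp only [Nat.cast_one, altSign_one, Int.cast_neg, Int.cast_one]
      linear_combination h
    | n + 2, hn, ih =>
      have h := binomSum_add_one_add_sub_one N ((n + 1 : ℕ) : R)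
      rw [← Nat.cast_add, Ring.choose_natCast, Nat.choose_eq_zero_of_lt (by omega)] at h
      have h0 := ih n (by omega) (by omega)
      rw [altSign_add_two]
      push_cast at h ⊢
      rw [show (n : R) + 1 + 1 = n + 2 by ring, show (n : R) + 1 - 1 = n by ring, h0] at h
      linear_combination h

end BinomialSum

/-! ### Quadratic dependence on t of S(r + p t) modulo p^2. -/

section PadicQuadratic

variable {p : ℕ} [hpr : Fact p.Prime]

theorem PadicInt.isUnit_natCast_of_not_dvd {n : ℕ} (h : ¬ p ∣ n) : IsUnit (n : ℤ_[p]) := by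
  rw [PadicInt.isUnit_iff]
  refine le_antisymm (PadicInt.norm_le_one _) (not_lt.mp fun hlt => h ?_)
  have := (PadicInt.norm_int_lt_one_iff_dvd (p := p) (n : ℤ)).mp (by simpa using hlt)
  exact_mod_cast this

theorem PadicInt.factorial_dvd_prime (hp2 : p ≠ 2) {m : ℕ} (hm : m < 2 * p) :
    (m.factorial : ℤ_[p]) ∣ p := by
  have hp3 : 3 ≤ p := by
    have := hpr.out.two_le
    omega
  obtain ⟨e, c, hc, he⟩ := Nat.exists_eq_pow_mul_and_not_dvd (Nat.factorial_ne_zero m) p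
    hpr.out.ne_one
  have he1 : e < 2 := by
    by_contra hcon
    have h2 : p ^ 2 ∣ m.factorial := by
      rw [he]
      exact Dvd.dvd.mul_right (pow_dvd_pow p (by omega)) c
    have hlog : Nat.log p m < 2 := Nat.log_lt_of_lt_pow' (by omega) (by nlinarith)
    rw [Nat.Prime.pow_dvd_factorial_iff hpr.out hlog] at h2
    have : m / p < 2 := Nat.div_lt_of_lt_mul (by omega)
    simp at h2
    omega
  rw [he, Nat.cast_mul, (PadicInt.isUnit_natCast_of_not_dvd hc).mul_right_dvd, Nat.cast_pow]
  simpa using pow_dvd_pow (p : ℤ_[p]) (show e ≤ 1 by omega)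

theorem Polynomial.exists_quadratic_approx {R : Type*} [CommRing R] (P : Polynomial R) :
    ∃ b c : R, ∀ y, y ^ 3 ∣ P.eval y - P.eval 0 - (b * y + c * y ^ 2) := by
  refine ⟨P.divX.coeff 0, P.divX.divX.coeff 0, fun y => ⟨P.divX.divX.divX.eval y, ?_⟩⟩
  have h : ∀ Q : Polynomial R, Q.eval y = Q.divX.eval y * y + Q.coeff 0 := fun Q => by
    conv_lhs => rw [← Q.divX_mul_X_add]
    simp
  rw [h P, h P.divX, h P.divX.divX, ← P.coeff_zero_eq_eval_zero]
  ring

/-- With p = m! v, the difference of binomial coefficients is v/p times a polynomial in p t without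
constant term; its terms of degree at least 3 are divisible by p^2. -/
theorem exists_quadratic_ringChoose (hp2 : p ≠ 2) (r : ℤ_[p]) {m : ℕ} (hm : m < 2 * p) :
    ∃ a b : ℤ_[p], ∀ t : ℤ_[p], (p : ℤ_[p]) ^ 2 ∣
      Ring.choose (r + p * t) m - Ring.choose r m - (a * t + b * t ^ 2) := by
  obtain ⟨v, hv⟩ := PadicInt.factorial_dvd_prime hp2 hm
  obtain ⟨b, c, h⟩ := Polynomial.exists_quadratic_approx
    (∏ i ∈ Finset.range m, (Polynomial.X + Polynomial.C (r - (i : ℤ_[p]))))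
  have hev : ∀ y : ℤ_[p], Polynomial.eval y
      (∏ i ∈ Finset.range m, (Polynomial.X + Polynomial.C (r - (i : ℤ_[p]))))
      = (m.factorial : ℤ_[p]) * Ring.choose (r + y) m := fun y => by
    rw [factorial_mul_ringChoose, Polynomial.eval_prod]
    refine Finset.prod_congr rfl fun i _ => ?_
    simp only [Polynomial.eval_add, Polynomial.eval_X, Polynomial.eval_C]
    ring
  refine ⟨v * b, v * c * p, fun t => ?_⟩
  obtain ⟨w, hw⟩ := h (p * t)
  rw [hev, hev, add_zero] at hw
  refine ⟨v * t ^ 3 * w, ?_⟩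
  have hp0 : (p : ℤ_[p]) ≠ 0 := Nat.cast_ne_zero.mpr hpr.out.ne_zero
  apply mul_left_cancel₀ hp0
  linear_combination v * hw +
    (Ring.choose (r + p * t) m - Ring.choose r m) * hv

theorem exists_quadratic_binomSum (hp2 : p ≠ 2) (r : ℤ_[p]) :
    ∃ a b : ℤ_[p], ∀ t : ℤ_[p], (p : ℤ_[p]) ^ 2 ∣
      binomSum p (r + p * t) - binomSum p r - (a * t + b * t ^ 2) := by
  have h : ∀ k ∈ Finset.range p, ∃ a b : ℤ_[p], ∀ t : ℤ_[p], (p : ℤ_[p]) ^ 2 ∣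
      Ring.choose (r + k + p * t) (2 * k) - Ring.choose (r + k) (2 * k) - (a * t + b * t ^ 2) :=
    fun k hk => exists_quadratic_ringChoose hp2 _ (by rw [Finset.mem_range] at hk; omega)
  choose! a b hab using h
  refine ⟨∑ k ∈ Finset.range p, a k * (-2) ^ k, ∑ k ∈ Finset.range p, b k * (-2) ^ k,
    fun t => ?_⟩
  rw [binomSum, binomSum, Finset.sum_mul, Finset.sum_mul, ← Finset.sum_add_distrib,
    ← Finset.sum_sub_distrib, ← Finset.sum_sub_distrib]
  refine Finset.dvd_sum fun k hk => ?_
  convert! (hab k hk t).mul_right ((-2) ^ k) using 1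
  rw [show r + p * t + (k : ℤ_[p]) = r + k + p * t by ring]
  ring

/-- Lagrange interpolation at t = 0, 1, -1, doubled to clear the denominators. -/
theorem binomSum_interpolation (hp2 : p ≠ 2) (r t : ℤ_[p]) :
    (p : ℤ_[p]) ^ 2 ∣ 2 * binomSum p (r + p * t) - (2 * (1 - t ^ 2) * binomSum p r
      + t * (t + 1) * binomSum p (r + p) + t * (t - 1) * binomSum p (r - p)) := by
  obtain ⟨a, b, h⟩ := exists_quadratic_binomSum hp2 r
  obtain ⟨u, hu⟩ := h t
  obtain ⟨v, hv⟩ := h 1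
  obtain ⟨w, hw⟩ := h (-1)
  rw [mul_one] at hv
  rw [show r + (p : ℤ_[p]) * -1 = r - p by ring] at hw
  refine ⟨2 * u - t * (t + 1) * v - t * (t - 1) * w, ?_⟩
  linear_combination 2 * hu - t * (t + 1) * hv - t * (t - 1) * hw

end PadicQuadratic

/-! ### Alternating power sums modulo p and the value S(n + p). -/

section AlternatingPowerSum

theorem sum_neg_one_pow_mul_add_shift {R : Type*} [CommRing R] (f : ℕ → R) (N : ℕ) :
    ∑ j ∈ Finset.range N, (-1) ^ j * f (j + 1) + ∑ j ∈ Finset.range N, (-1) ^ j * f j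
      = f 0 - (-1) ^ N * f N := by
  induction N with
  | zero => simp
  | succ N ih =>
    rw [Finset.sum_range_succ, Finset.sum_range_succ, pow_succ]
    linear_combination ih

variable {p : ℕ} [hpr : Fact p.Prime]

/-- The alternating sum of the `(p - 2)`-th powers of `y, y + 1, ..., y + p - 1` in `ZMod p`. -/
def altPowSum (y : ZMod p) : ZMod p := ∑ j ∈ Finset.range p, (-1) ^ j * (y + j) ^ (p - 2)

theorem ZMod.pow_sub_two_eq_inv (hp2 : p ≠ 2) (a : ZMod p) : a ^ (p - 2) = a⁻¹ := by
  have := hpr.out.two_le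
  rcases eq_or_ne a 0 with rfl | ha
  · rw [inv_zero, zero_pow (by omega)]
  · apply mul_right_cancel₀ ha
    rw [inv_mul_cancel₀ ha, ← pow_succ, show p - 2 + 1 = p - 1 by omega,
      ZMod.pow_card_sub_one_eq_one ha]

/-- The sum telescopes to two end terms, equal because p is odd and zero in `ZMod p`. The exponent p
- 2 is inversion, also at 0. -/
theorem altPowSum_add_one (hp : Odd p) (y : ZMod p) :
    altPowSum (y + 1) + altPowSum y = 2 * y⁻¹ := by
  have hp2 : p ≠ 2 := by rintro rfl; revert hp; decide
  have h := sum_neg_one_pow_mul_add_shift (fun j => (y + (j : ZMod p)) ^ (p - 2)) p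
  simp only [ZMod.natCast_self, Nat.cast_zero, add_zero, hp.neg_one_pow] at h
  rw [← ZMod.pow_sub_two_eq_inv hp2, altPowSum, altPowSum]
  have h2 : ∀ j ∈ Finset.range p, (-1 : ZMod p) ^ j * (y + 1 + j) ^ (p - 2)
      = (-1) ^ j * (y + ((j + 1 : ℕ) : ZMod p)) ^ (p - 2) := fun j _ => by
    push_cast
    ring
  rw [Finset.sum_congr rfl h2, h]
  ring

theorem ZMod.two_ne_zero_of_odd (hp : Odd p) : (2 : ZMod p) ≠ 0 := by
  intro h
  have h2 : ((2 : ℕ) : ZMod p) = 0 := by exact_mod_cast h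
  rw [ZMod.natCast_eq_zero_iff] at h2
  have := (Nat.prime_dvd_prime_iff_eq hpr.out Nat.prime_two).mp h2
  subst this
  revert hp
  decide

/-- Under j ↦ p - 1 - j the base 1/2 + j changes sign while (-1)^j does not; the exponent p - 2 is
odd, so the sum is its own negative. -/
theorem altPowSum_half (hp : Odd p) : altPowSum (2⁻¹ : ZMod p) = 0 := by
  have h2 := ZMod.two_ne_zero_of_odd hp
  have hp3 : 3 ≤ p := by
    have := hpr.out.two_le
    obtain ⟨k, hk⟩ := hp
    omega
  have hodd : Odd (p - 2) := by
    obtain ⟨k, hk⟩ := hp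
    exact ⟨k - 1, by omega⟩
  suffices h : altPowSum (2⁻¹ : ZMod p) = -altPowSum (2⁻¹ : ZMod p) by
    have h3 : 2 * altPowSum (2⁻¹ : ZMod p) = 0 := by linear_combination h
    exact (mul_eq_zero.mp h3).resolve_left h2
  conv_lhs => rw [altPowSum, ← Finset.sum_range_reflect]
  rw [altPowSum, ← Finset.sum_neg_distrib]
  refine Finset.sum_congr rfl fun j hj => ?_
  rw [Finset.mem_range] at hj
  have h1 : (2⁻¹ : ZMod p) + ((p - 1 - j : ℕ) : ZMod p) = -(2⁻¹ + j) := by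
    rw [show p - 1 - j = p - (1 + j) by omega, Nat.cast_sub (by omega), ZMod.natCast_self]
    push_cast
    have : (2⁻¹ : ZMod p) + 2⁻¹ = 1 := by field_simp; norm_num
    linear_combination this
  have hs : (-1 : ZMod p) ^ (p - 1 - j) = (-1) ^ j := by
    rw [← mul_left_inj' (pow_ne_zero j (neg_ne_zero.mpr (one_ne_zero (α := ZMod p)))), ← pow_add,
      ← pow_add, show p - 1 - j + j = p - 1 by omega, (Even.add_self j).neg_one_pow,
      (Nat.Odd.sub_odd hp odd_one).neg_one_pow]
  rw [h1, hs, hodd.neg_pow]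
  ring

theorem ZMod.natCast_choose_sub_one {j : ℕ} (hj : j < p) :
    (((p - 1).choose j : ℕ) : ZMod p) = (-1) ^ j := by
  induction j with
  | zero => simp
  | succ j ih =>
    have h := Nat.choose_succ_succ' (p - 1) j
    rw [Nat.sub_add_cancel hpr.out.one_le] at h
    have h0 : ((p.choose (j + 1) : ℕ) : ZMod p) = 0 :=
      (ZMod.natCast_eq_zero_iff _ _).mpr (hpr.out.dvd_choose_self (by omega) hj)
    rw [h, Nat.cast_add, ih (by omega)] at h0
    rw [pow_succ]
    linear_combination h0

theorem ZMod.natCast_ne_zero_of_lt {j : ℕ} (h0 : j ≠ 0) (hj : j < p) : (j : ZMod p) ≠ 0 := by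
  rw [Ne, ZMod.natCast_eq_zero_iff]
  exact fun h => absurd (Nat.le_of_dvd (by omega) h) (by omega)

/-- `altPowSum 0` is minus the Fermat quotient of `2`, doubled. -/
theorem exists_two_pow_eq_altPowSum_zero (hp : Odd p) :
    ∃ k : ℕ, 2 ^ p = 2 + p * k ∧ (k : ZMod p) = -altPowSum (0 : ZMod p) := by
  have hp2 : p ≠ 2 := by rintro rfl; revert hp; decide
  have hdiv : ∀ j ∈ Finset.range (p - 1), ∃ c : ℕ, p.choose (j + 1) = p * c := fun j hj => by
    rw [Finset.mem_range] at hj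
    exact hpr.out.dvd_choose_self (by omega) (by omega)
  choose! c hc using hdiv
  refine ⟨∑ j ∈ Finset.range (p - 1), c j, ?_, ?_⟩
  · rw [← Nat.sum_range_choose, Finset.sum_range_succ, Finset.mul_sum,
      ← Finset.sum_congr rfl hc]
    obtain ⟨q, hq⟩ : ∃ q, p = q + 1 := ⟨p - 1, by have := hpr.out.one_le; omega⟩
    rw [hq, Finset.sum_range_succ', Nat.choose_self, Nat.add_sub_cancel, Nat.choose_zero_right]
    ring
  · have hG : altPowSum (0 : ZMod p)
        = ∑ j ∈ Finset.range (p - 1), (-1) ^ (j + 1) * (((j + 1 : ℕ) : ZMod p))⁻¹ := by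
      rw [altPowSum]
      rw [show Finset.range p = Finset.range (p - 1 + 1) by
        rw [Nat.sub_add_cancel hpr.out.one_le], Finset.sum_range_succ']
      simp only [ZMod.pow_sub_two_eq_inv hp2]
      simp
    rw [hG, Nat.cast_sum, ← Finset.sum_neg_distrib]
    refine Finset.sum_congr rfl fun j hj => ?_
    have hj' := Finset.mem_range.mp hj
    have hne : ((j + 1 : ℕ) : ZMod p) ≠ 0 := ZMod.natCast_ne_zero_of_lt (by omega) (by omega)
    -- C(p, j+1)/p = C(p-1, j)/(j+1), which is (-1)^j/(j+1) modulo p.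
    have h1 := Nat.add_one_mul_choose_eq (p - 1) j
    rw [Nat.sub_add_cancel hpr.out.one_le, hc j hj, mul_assoc] at h1
    have h2 := Nat.eq_of_mul_eq_mul_left hpr.out.pos h1
    have h3 : (((p - 1).choose j : ℕ) : ZMod p) = c j * ((j + 1 : ℕ) : ZMod p) := by
      rw [h2, Nat.cast_mul]
    rw [ZMod.natCast_choose_sub_one (by omega)] at h3
    rw [pow_succ, h3]
    field_simp

/-- The numerator is (2p + i) ⋯ (2p + 1) · 2p · (2p - 1); apart from the factor p it is -2 · i!
modulo p. -/
theorem exists_choose_two_mul_add (i : ℕ) (hi : i + 2 < p) :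
    ∃ c : ℕ, (2 * p + i).choose (i + 2) = p * c ∧
      (c : ZMod p) * ((i + 1) * (i + 2)) = -2 := by
  have h := Nat.descFactorial_eq_factorial_mul_choose (2 * p + i) (i + 2)
  rw [Nat.descFactorial_succ, Nat.descFactorial_succ,
    show 2 * p + i - (i + 1) = 2 * p - 1 by omega, show 2 * p + i - i = 2 * p by omega] at h
  have hdvd : p ∣ (2 * p + i).choose (i + 2) := by
    have h1 : p ∣ (i + 2).factorial * (2 * p + i).choose (i + 2) := by
      rw [← h]
      exact ⟨(2 * p - 1) * (2 * (2 * p + i).descFactorial i), by ring⟩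
    exact (hpr.out.dvd_mul.mp h1).resolve_left fun h2 => by
      have := (hpr.out.dvd_factorial).mp h2
      omega
  obtain ⟨c, hc⟩ := hdvd
  refine ⟨c, hc, ?_⟩
  have h2 : (2 * p - 1) * (2 * (2 * p + i).descFactorial i) = (i + 2).factorial * c := by
    apply Nat.eq_of_mul_eq_mul_left hpr.out.pos
    rw [hc] at h
    linear_combination h
  have h3 := congrArg (Nat.cast : ℕ → ZMod p) h2
  have hd : (((2 * p + i).descFactorial i : ℕ) : ZMod p) = (i.factorial : ZMod p) := by
    rw [← descPochhammer_eval_eq_descFactorial, ← Nat.descFactorial_self,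
      ← descPochhammer_eval_eq_descFactorial]
    simp
  rw [Nat.factorial_succ, Nat.factorial_succ] at h3
  push_cast [Nat.cast_sub (show 1 ≤ 2 * p by have := hpr.out.one_le; omega)] at h3
  rw [hd, ZMod.natCast_self] at h3
  have hf : (i.factorial : ZMod p) ≠ 0 := by
    rw [Ne, ZMod.natCast_eq_zero_iff, hpr.out.dvd_factorial]
    omega
  apply mul_right_cancel₀ hf
  linear_combination -h3

theorem binomSum_add_prime_eq (hp : Odd p) (n : ℕ) (hn : n < p) :
    ∃ k : ℤ_[p], binomSum p ((n : ℤ_[p]) + p) = 2 * (altSign n : ℤ_[p])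
        - (altSign (p - 1 - n) : ℤ_[p]) + p * k ∧
      PadicInt.toZMod k = -(altPowSum (-n / 2 : ZMod p) + altPowSum ((n + 1) / 2 : ZMod p)) := by
  obtain ⟨s, hs⟩ : ∃ s, p = 2 * s + 3 := by
    obtain ⟨s, hs⟩ := hp
    have := hpr.out.two_le
    exact ⟨s - 1, by omega⟩
  have h2 := ZMod.two_ne_zero_of_odd hp
  obtain ⟨k₀, hk₀, hk₀'⟩ := exists_two_pow_eq_altPowSum_zero hp
  have hk₀'' : (2 : ℤ_[p]) ^ p = 2 + p * k₀ := by exact_mod_cast congrArg (Nat.cast : ℕ → ℤ_[p]) hk₀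
  have hrec : ∀ m : ℕ, binomSum p (((m + 1 : ℕ) : ℤ_[p]) + p)
      + binomSum p ((m : ℤ_[p]) + p - 1)
      = 2 ^ p * (((2 * p + m - 1).choose (m + 1) : ℕ) : ℤ_[p]) := by
    intro m
    have h := binomSum_add_one_add_sub_one (p - 1) ((m : ℤ_[p]) + p)
    rw [Nat.sub_add_cancel hpr.out.one_le, hp.neg_pow, neg_neg, ← Nat.cast_add, ← Nat.cast_add,
      Ring.choose_natCast, Nat.choose_symm_of_eq_add
        (show m + p + (p - 1) = 2 * (p - 1) + (m + 1) by omega),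
      show m + p + (p - 1) = 2 * p + m - 1 by omega] at h
    rw [← h]
    push_cast
    congr 2
    ring
  have he : altSign (p - 1) = altSign (p - 2) := by
    rw [show p - 1 = 2 * (s + 1) by omega, show p - 2 = 2 * s + 1 by omega, altSign_two_mul,
      altSign_two_mul_add_one]
  induction n using Nat.strong_induction_on with
  | _ n ih =>
    match n, hn, ih with
    | 0, _, _ =>
      -- The recurrence gives S(p) + S(p - 2) = 2^p, so the Fermat quotient of 2 enters here; G(1/2)
      -- = 0.
      refine ⟨k₀, ?_, ?_⟩
      · have h := binomSum_add_one_add_sub_one (p - 1) ((p - 1 : ℕ) : ℤ_[p])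
        rw [Nat.sub_add_cancel hpr.out.one_le, hp.neg_pow, neg_neg, ← Nat.cast_add,
          Ring.choose_natCast, show p - 1 + (p - 1) = 2 * (p - 1) by omega, Nat.choose_self,
          show ((p - 1 : ℕ) : ℤ_[p]) + 1 = p by
            rw [← Nat.cast_add_one, Nat.sub_add_cancel hpr.out.one_le],
          show ((p - 1 : ℕ) : ℤ_[p]) - 1 = ((p - 2 : ℕ) : ℤ_[p]) by
            rw [show p - 1 = p - 2 + 1 by omega]; push_cast; ring,
          binomSum_natCast _ (show p - 2 < p by omega), hk₀''] at h
        rw [altSign_zero, Nat.sub_zero, he, Nat.cast_zero, zero_add]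
        push_cast at h ⊢
        linear_combination h
      · rw [map_natCast, hk₀', Nat.cast_zero, neg_zero, zero_div, zero_add, one_div,
          altPowSum_half hp, add_zero]
    | 1, _, _ =>
      -- Here S(p + 1) + S(p - 1) = 2^p (2p - 1), whose factor 2p - 1 is not divisible by p; hence a
      -- separate base case.
      refine ⟨2 * 2 ^ p - k₀, ?_, ?_⟩
      · have h := hrec 0
        rw [show ((0 : ℕ) : ℤ_[p]) + p - 1 = ((p - 1 : ℕ) : ℤ_[p]) by
            rw [Nat.cast_sub hpr.out.one_le]; push_cast; ring,
          binomSum_natCast _ (show p - 1 < p by omega), zero_add, Nat.choose_one_right, he,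
          Nat.cast_sub (by omega)] at h
        rw [altSign_one, show p - 1 - 1 = p - 2 by omega]
        push_cast at h ⊢
        linear_combination h - hk₀''
      · have h1 := altPowSum_add_one hp (-1 / 2 : ZMod p)
        have h3 := altPowSum_add_one hp (0 : ZMod p)
        rw [show (-1 / 2 : ZMod p) + 1 = 2⁻¹ by field_simp; norm_num, altPowSum_half hp,
          show (-1 / 2 : ZMod p)⁻¹ = -2 by field_simp] at h1
        rw [zero_add, inv_zero] at h3
        simp only [map_sub, map_mul, map_pow, map_ofNat, map_natCast, ZMod.pow_card, hk₀']
        rw [Nat.cast_one, show (1 + 1 : ZMod p) / 2 = 1 by field_simp; norm_num]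
        linear_combination h1 + h3
    | i + 2, hn, ih =>
      obtain ⟨k, hk, hk'⟩ := ih i (by omega) (by omega)
      obtain ⟨c, hc, hc'⟩ := exists_choose_two_mul_add (p := p) i hn
      -- Modulo p, 2^p c is -4/((i+1)(i+2)), which is minus the sum of the two increments 2/y of G
      -- at y = -(i+2)/2 and y = (i+1)/2.
      refine ⟨2 ^ p * c - k, ?_, ?_⟩
      · have h := hrec (i + 1)
        rw [show ((i + 1 : ℕ) : ℤ_[p]) + p - 1 = i + p by push_cast; ring, hk,
          show 2 * p + (i + 1) - 1 = 2 * p + i by omega, hc] at h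
        have hm : altSign (p - 1 - i) = -altSign (p - 1 - (i + 2)) := by
          rw [show p - 1 - i = p - 1 - (i + 2) + 2 by omega, altSign_add_two]
        rw [hm] at h
        rw [altSign_add_two]
        push_cast at h ⊢
        rw [show (i : ℤ_[p]) + 1 + 1 = i + 2 by ring] at h
        linear_combination h
      · have h1 := altPowSum_add_one hp (-((i + 2 : ℕ) : ZMod p) / 2)
        have h3 := altPowSum_add_one hp ((i + 1 : ZMod p) / 2)
        have hn1 : ((i + 1 : ℕ) : ZMod p) ≠ 0 := ZMod.natCast_ne_zero_of_lt (by omega) (by omega)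
        have hn2 : ((i + 2 : ℕ) : ZMod p) ≠ 0 := ZMod.natCast_ne_zero_of_lt (by omega) hn
        push_cast at hn1 hn2 h1 h3 ⊢
        rw [show -((i : ZMod p) + 2) / 2 + 1 = -i / 2 by field_simp; ring] at h1
        rw [show ((i : ZMod p) + 1) / 2 + 1 = (i + 2 + 1) / 2 by field_simp; ring] at h3
        simp only [map_sub, map_mul, map_pow, map_ofNat, map_natCast, ZMod.pow_card, hk']
        have hc'' : (c : ZMod p) = -2 / ((i + 1) * (i + 2)) := by
          field_simp
          linear_combination hc'
        have hI : 2 * (-((i : ZMod p) + 2) / 2)⁻¹ + 2 * (((i : ZMod p) + 1) / 2)⁻¹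
            = -2 * (-2 / ((i + 1) * (i + 2))) := by
          field_simp
          ring
        rw [hc'']
        linear_combination h1 + h3 + hI

theorem binomSum_modEq (hp : Odd p) {n : ℕ} (hn : n < p) {x t γ : ℤ_[p]} (hx : x = n + p * t)
    (hxt : x * (x + 1) = t * (t + 1))
    (hγ : PadicInt.toZMod γ = altPowSum (-PadicInt.toZMod x / 2)
      + altPowSum ((PadicInt.toZMod x + 1) / 2)) :
    (p : ℤ_[p]) ^ 2 ∣ 2 * binomSum p x - (2 * (1 + t) * altSign n
      - 2 * t * altSign (p - 1 - n) - p * (x * (x + 1)) * γ) := by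
  have hp2 : p ≠ 2 := by rintro rfl; revert hp; decide
  obtain ⟨w, hw⟩ := binomSum_interpolation hp2 (n : ℤ_[p]) t
  obtain ⟨k, hk, hk'⟩ := binomSum_add_prime_eq hp n hn
  have hxn : PadicInt.toZMod x = (n : ZMod p) := by simp [hx]
  have hkγ : PadicInt.toZMod (k + γ) = 0 := by rw [map_add, hk', hγ, hxn]; ring
  have hdvd : (p : ℤ_[p]) ∣ k + γ := by
    rw [← RingHom.mem_ker, PadicInt.ker_toZMod, PadicInt.maximalIdeal_eq_span_p,
      Ideal.mem_span_singleton] at hkγ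
    exact hkγ
  obtain ⟨l, hl⟩ := hdvd
  -- Reflection sends n - p to p - 1 - n, again in the range where S is a sign.
  have hr : binomSum p ((n : ℤ_[p]) - p) = altSign (p - 1 - n) := by
    rw [← binomSum_reflect, ← binomSum_natCast _ (show p - 1 - n < p by omega)]
    congr 1
    rw [show p - 1 - n = p - (1 + n) by omega, Nat.cast_sub (by omega)]
    push_cast
    ring
  rw [← hx, hk, hr, binomSum_natCast _ hn] at hw
  refine ⟨w + t * (t + 1) * l, ?_⟩
  linear_combination hw + p * γ * hxt + p * t * (t + 1) * hl

end AlternatingPowerSum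

/-! ### Euler polynomials: difference equation, p-integrality, reduction modulo p. -/

section EulerPolynomials

theorem mk_eulerPoly (x : ℚ) :
    PowerSeries.mk (fun n => eulerPoly n x / (n.factorial : ℚ)) =
      2 * PowerSeries.rescale x (PowerSeries.exp ℚ) * (PowerSeries.exp ℚ + 1)⁻¹ := by
  ext n
  rw [PowerSeries.coeff_mk, eulerPoly,
    mul_div_cancel_left₀ _ (Nat.cast_ne_zero.mpr n.factorial_ne_zero)]

theorem eulerPoly_add_one (n : ℕ) (x : ℚ) :
    eulerPoly n (x + 1) + eulerPoly n x = 2 * x ^ n := by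
  have h1 : PowerSeries.rescale (x + 1) (PowerSeries.exp ℚ) =
      PowerSeries.rescale x (PowerSeries.exp ℚ) * PowerSeries.exp ℚ := by
    rw [← PowerSeries.exp_mul_exp_eq_exp_add, PowerSeries.rescale_one]
    rfl
  have h2 : PowerSeries.mk (fun n => eulerPoly n (x + 1) / (n.factorial : ℚ)) +
      PowerSeries.mk (fun n => eulerPoly n x / (n.factorial : ℚ)) =
        2 * PowerSeries.rescale x (PowerSeries.exp ℚ) := by
    rw [← eulerPoly_generating_function x, mk_eulerPoly x, mk_eulerPoly (x + 1), h1]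
    ring
  have h3 := congrArg (PowerSeries.coeff n) h2
  have hf : (n.factorial : ℚ) ≠ 0 := Nat.cast_ne_zero.mpr n.factorial_ne_zero
  rw [map_add, PowerSeries.coeff_mk, PowerSeries.coeff_mk,
    show (2 : PowerSeries ℚ) = PowerSeries.C (2 : ℚ) from rfl, PowerSeries.coeff_C_mul,
    PowerSeries.coeff_rescale, PowerSeries.coeff_exp] at h3
  simp only [eq_ratCast, Rat.cast_id] at h3
  field_simp at h3
  linear_combination h3

theorem eulerPoly_eq_sum (n : ℕ) (x : ℚ) :
    eulerPoly n x = ∑ k ∈ Finset.range (n + 1), (n.choose k : ℚ) * eulerPoly k 0 * x ^ (n - k) := by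
  have h : PowerSeries.mk (fun n => eulerPoly n x / (n.factorial : ℚ)) =
      PowerSeries.mk (fun n => eulerPoly n 0 / (n.factorial : ℚ)) *
        PowerSeries.rescale x (PowerSeries.exp ℚ) := by
    rw [mk_eulerPoly x, mk_eulerPoly 0]
    simp only [PowerSeries.rescale_zero_apply, PowerSeries.constantCoeff_exp, map_one]
    ring
  have h3 := congrArg (PowerSeries.coeff n) h
  have hf : ∀ n : ℕ, (n.factorial : ℚ) ≠ 0 := fun n => Nat.cast_ne_zero.mpr n.factorial_ne_zero
  rw [PowerSeries.coeff_mk, PowerSeries.coeff_mul,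
    Finset.Nat.sum_antidiagonal_eq_sum_range_succ_mk, div_eq_iff (hf n), Finset.sum_mul] at h3
  rw [h3]
  refine Finset.sum_congr rfl fun k hk => ?_
  rw [Finset.mem_range] at hk
  rw [PowerSeries.coeff_mk, PowerSeries.coeff_rescale, PowerSeries.coeff_exp,
    Nat.cast_choose ℚ (show k ≤ n by omega)]
  simp only [eq_ratCast, Rat.cast_id]
  have := hf k
  have := hf (n - k)
  field_simp

variable {p : ℕ} [hpr : Fact p.Prime]

theorem PadicInt.coe_two : ((2 : ℤ_[p]) : ℚ_[p]) = 2 := map_ofNat PadicInt.Coe.ringHom 2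

theorem PadicInt.coe_prod {ι : Type*} (s : Finset ι) (f : ι → ℤ_[p]) :
    ((∏ i ∈ s, f i : ℤ_[p]) : ℚ_[p]) = ∏ i ∈ s, (f i : ℚ_[p]) :=
  map_prod PadicInt.Coe.ringHom f s

theorem PadicInt.exists_two_mul_eq_one (hp : Odd p) : ∃ h : ℤ_[p], 2 * h = 1 := by
  have h2 : ¬ p ∣ 2 := fun h => by
    rw [Nat.prime_dvd_prime_iff_eq hpr.out Nat.prime_two] at h
    subst h
    revert hp
    decide
  obtain ⟨h, hh⟩ := (PadicInt.isUnit_natCast_of_not_dvd h2).exists_right_inv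
  exact ⟨h, by exact_mod_cast hh⟩

/-- E_n(1) + E_n(0) = 2 · 0^n, with E_n(1) expanded at 0, expresses 2 E_n(0) through lower values;
only the unit 2 is inverted. -/
theorem exists_padicInt_eulerPoly_zero (hp : Odd p) (n : ℕ) :
    ∃ v : ℤ_[p], (v : ℚ_[p]) = (eulerPoly n 0 : ℚ) := by
  obtain ⟨h, hh⟩ := PadicInt.exists_two_mul_eq_one hp
  have hh' : (2 : ℚ_[p]) * h = 1 := by simpa [PadicInt.coe_two] using congrArg (Subtype.val) hh
  induction n using Nat.strong_induction_on with
  | _ n ih =>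
    choose! v hv using ih
    have h1 := eulerPoly_add_one n 0
    rw [eulerPoly_eq_sum n (0 + 1), Finset.sum_range_succ] at h1
    simp only [zero_add, one_pow, mul_one, Nat.choose_self, Nat.cast_one, one_mul] at h1
    refine ⟨h * (2 * 0 ^ n - ∑ k ∈ Finset.range n, (n.choose k : ℤ_[p]) * v k), ?_⟩
    have h2 := congrArg (Rat.cast : ℚ → ℚ_[p]) h1
    have h3 : ∑ k ∈ Finset.range n, (n.choose k : ℚ_[p]) * (eulerPoly k 0 : ℚ)
        = ∑ k ∈ Finset.range n, (n.choose k : ℚ_[p]) * (v k : ℚ_[p]) :=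
      Finset.sum_congr rfl fun k hk => by rw [hv k (Finset.mem_range.mp hk)]
    push_cast [PadicInt.coe_two, PadicInt.coe_sum] at h2 ⊢
    rw [h3] at h2
    linear_combination (eulerPoly n 0 : ℚ_[p]) * hh' - h * h2

theorem exists_padicInt_eulerPoly (hp : Odd p) {y : ℚ} {u : ℤ_[p]} (hu : (u : ℚ_[p]) = y) :
    ∃ v : ℤ_[p], (v : ℚ_[p]) = (eulerPoly (p - 2) y : ℚ) ∧
      PadicInt.toZMod v = altPowSum (PadicInt.toZMod u) := by
  choose a ha using exists_padicInt_eulerPoly_zero (p := p) hp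
  set n := p - 2 with hn
  set P : Polynomial ℤ_[p] := ∑ k ∈ Finset.range (n + 1),
    Polynomial.C ((n.choose k : ℤ_[p]) * a k) * Polynomial.X ^ (n - k) with hP
  have hPe : ∀ (y : ℚ) (u : ℤ_[p]), (u : ℚ_[p]) = y →
      ((P.eval u : ℤ_[p]) : ℚ_[p]) = (eulerPoly n y : ℚ) := by
    intro y u hu
    rw [hP, Polynomial.eval_finsetSum, eulerPoly_eq_sum,
      PadicInt.coe_sum]
    push_cast
    refine Finset.sum_congr rfl fun k _ => ?_
    simp only [Polynomial.eval_mul, Polynomial.eval_C, Polynomial.eval_pow, Polynomial.eval_X]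
    push_cast
    rw [ha, hu]
  have hadd : ∀ j : ℕ, P.eval (u + (j + 1 : ℕ)) + P.eval (u + j) = 2 * (u + j) ^ n := by
    intro j
    apply Subtype.coe_injective
    have h1 := hPe (y + j + 1) (u + (j + 1 : ℕ)) (by push_cast; rw [hu]; ring)
    have h2 := hPe (y + j) (u + j) (by push_cast; rw [hu])
    have h3 := congrArg (Rat.cast : ℚ → ℚ_[p]) (eulerPoly_add_one n (y + j))
    push_cast [PadicInt.coe_two] at h1 h2 h3 ⊢
    rw [h1, h2, hu]
    exact h3
  refine ⟨P.eval u, hPe y u hu, ?_⟩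
  -- Telescoping gives E(u) + E(u + p) = 2 Σ (-1)^j (u + j)^(p-2), and E(u + p) ≡ E(u) modulo p
  -- because the coefficients are p-integral.
  have hs := sum_neg_one_pow_mul_add_shift (fun j : ℕ => P.eval (u + j)) p
  simp only [← Finset.sum_add_distrib, ← mul_add, hadd] at hs
  have hz := congrArg (PadicInt.toZMod (p := p)) hs
  obtain ⟨w, hw⟩ := Polynomial.sub_dvd_eval_sub (u + p) u P
  have hw' := congrArg (PadicInt.toZMod (p := p)) hw
  simp only [map_sub, map_add, map_mul, map_natCast, ZMod.natCast_self, add_zero, sub_self,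
    zero_mul] at hw'
  rw [hp.neg_one_pow] at hz
  simp only [map_sub, map_mul, map_neg, map_one, map_sum, map_pow, map_add, map_ofNat,
    map_natCast, Nat.cast_zero, add_zero] at hz
  apply mul_left_cancel₀ (ZMod.two_ne_zero_of_odd hp)
  rw [altPowSum, Finset.mul_sum]
  have hr : ∀ j ∈ Finset.range p, 2 * ((-1 : ZMod p) ^ j * (PadicInt.toZMod u + j) ^ (p - 2))
      = (-1) ^ j * (2 * (PadicInt.toZMod u + j) ^ n) := fun j _ => by rw [hn]; ring
  rw [Finset.sum_congr rfl hr, hz]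
  linear_combination -hw'

end EulerPolynomials

/-! ### The congruence for any sum with the right term ratio. -/

section Congruence

variable {p : ℕ} [hpr : Fact p.Prime]

/-- Passing from k to k + 1 adds the factors x + k + 1 and x - k at the two ends of the product. -/
theorem factorial_mul_eq_of_ratio {x : ℚ} {A : ℕ → ℚ} (h0 : A 0 = 1)
    (h : ∀ k : ℕ, (2 * k + 1) * (2 * k + 2) * A (k + 1) = -2 * ((x + k + 1) * (x - k)) * A k)
    (k : ℕ) :
    ((2 * k).factorial : ℚ) * A k = (-2) ^ k * ∏ i ∈ Finset.range (2 * k), (x + k - i) := by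
  induction k with
  | zero => simp [h0]
  | succ k ih =>
    rw [show 2 * (k + 1) = 2 * k + 1 + 1 by ring, Finset.prod_range_succ,
      Finset.prod_range_succ', Nat.factorial_succ, Nat.factorial_succ]
    have hs : ∏ i ∈ Finset.range (2 * k), (x + ((k + 1 : ℕ) : ℚ) - ((i + 1 : ℕ) : ℚ))
        = ∏ i ∈ Finset.range (2 * k), (x + k - i) :=
      Finset.prod_congr rfl fun i _ => by push_cast; ring
    rw [hs]
    push_cast
    linear_combination ((2 * k).factorial : ℚ) * h k + (-2) * ((x + k + 1) * (x - k)) * ih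

theorem padicModEq_sum (hp : Odd p) {n : ℕ} (hn : n < p) {x t : ℚ} (ht : ‖(t : ℚ_[p])‖ ≤ 1)
    (hx : x = n + p * t) (hxt : x * (x + 1) = t * (t + 1)) {A : ℕ → ℚ} (h0 : A 0 = 1)
    (h : ∀ k : ℕ, (2 * k + 1) * (2 * k + 2) * A (k + 1) = -2 * ((x + k + 1) * (x - k)) * A k) :
    PadicModEq p 2 (∑ k ∈ Finset.range p, A k)
      ((1 + t) * altSign n - t * altSign (p - 1 - n)
        - p * (x * (x + 1)) / 2 * (eulerPoly (p - 2) (-x / 2) + eulerPoly (p - 2) ((x + 1) / 2))) := by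
  obtain ⟨H, hH⟩ := PadicInt.exists_two_mul_eq_one hp
  have hH' : (H : ℚ_[p]) = 1 / 2 := by
    have : (2 : ℚ_[p]) * H = 1 := by simpa [PadicInt.coe_two] using congrArg (Subtype.val) hH
    linear_combination this / 2
  have hHz : PadicInt.toZMod H = (2 : ZMod p)⁻¹ := by
    have h1 := congrArg (PadicInt.toZMod (p := p)) hH
    simp only [map_mul, map_ofNat, map_one] at h1
    exact eq_inv_of_mul_eq_one_right h1
  obtain ⟨T, hT⟩ : ∃ T : ℤ_[p], (T : ℚ_[p]) = t := ⟨⟨t, ht⟩, rfl⟩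
  obtain ⟨X, hX⟩ : ∃ X : ℤ_[p], X = n + p * T := ⟨_, rfl⟩
  have hXx : (X : ℚ_[p]) = x := by rw [hX, hx]; push_cast; rw [hT]
  obtain ⟨v₁, hv₁, hz₁⟩ := exists_padicInt_eulerPoly hp (y := -x / 2) (u := -X * H) (by
    push_cast; rw [hXx, hH']; ring)
  obtain ⟨v₂, hv₂, hz₂⟩ := exists_padicInt_eulerPoly hp (y := (x + 1) / 2) (u := (X + 1) * H) (by
    push_cast; rw [hXx, hH']; ring)
  have hXT : X * (X + 1) = T * (T + 1) := by
    apply Subtype.coe_injective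
    push_cast
    rw [hXx, hT]
    exact_mod_cast congrArg (Rat.cast : ℚ → ℚ_[p]) hxt
  obtain ⟨w, hw⟩ := binomSum_modEq hp hn hX hXT (γ := v₁ + v₂) (by
    rw [map_add, hz₁, hz₂, map_mul, map_mul, hHz, map_neg, map_add, map_one, div_eq_mul_inv,
      div_eq_mul_inv])
  refine ⟨binomSum p X, (1 + T) * altSign n - T * altSign (p - 1 - n)
    - p * (X * (X + 1)) * H * (v₁ + v₂), ?_, ?_, ⟨H * w, ?_⟩⟩
  -- Each term equals a binomial coefficient of a p-adic integer, so it is p-integral whatever its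
  -- denominator.
  · rw [binomSum, PadicInt.coe_sum]
    push_cast [PadicInt.coe_two]
    refine Finset.sum_congr rfl fun k _ => ?_
    have hf : ((2 * k).factorial : ℚ_[p]) ≠ 0 := Nat.cast_ne_zero.mpr (Nat.factorial_ne_zero _)
    apply mul_left_cancel₀ hf
    have h1 := congrArg (fun z : ℤ_[p] => (z : ℚ_[p])) (factorial_mul_ringChoose (X + k) (2 * k))
    have h2 := congrArg (Rat.cast : ℚ → ℚ_[p]) (factorial_mul_eq_of_ratio h0 h k)
    simp only [PadicInt.coe_mul, PadicInt.coe_natCast, PadicInt.coe_prod] at h1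
    push_cast at h1 h2
    rw [hXx] at h1
    rw [h2, ← mul_assoc, h1]
    ring
  · push_cast
    rw [hXx, hT, hv₁, hv₂, hH']
    ring
  · linear_combination H * hw - (binomSum p X - ((1 + T) * altSign n - T * altSign (p - 1 - n))) * hH

end Congruence

/-! ### Legendre symbols of 3 and 6 as signs. -/

section LegendreSymbols

theorem altSign_four_mul_add (r i : ℕ) : altSign (4 * r + i) = altSign i := by
  induction r with
  | zero => simp
  | succ r ih =>
    rw [show 4 * (r + 1) + i = 4 * r + i + 2 + 2 by ring, altSign_add_two, altSign_add_two, ih,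
      neg_neg]

variable {p : ℕ} [hpr : Fact p.Prime]

theorem legendreSym_three_eq (hp : Odd p) (h3 : 3 < p) :
    legendreSym p 3 = (-1) ^ (p / 2) * legendreSym 3 p := by
  have hp2 : p ≠ 2 := by rintro rfl; revert hp; decide
  have : Fact (Nat.Prime 3) := ⟨Nat.prime_three⟩
  have h := legendreSym.quadratic_reciprocity' (p := 3) (q := p) (by norm_num) hp2
  simpa using h

theorem legendreSym_three_of_six_mul_add_one (hp : Odd p) (h3 : 3 < p) {s : ℕ}
    (hs : p = 6 * s + 1) : legendreSym p 3 = (-1) ^ s := by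
  have : Fact (Nat.Prime 3) := ⟨Nat.prime_three⟩
  rw [legendreSym_three_eq hp h3, legendreSym.mod 3 (p : ℤ), show p / 2 = 3 * s by omega,
    show (p : ℤ) % (3 : ℕ) = 1 by omega, legendreSym.at_one, pow_mul, mul_one]
  norm_num

theorem legendreSym_three_of_six_mul_add_five (hp : Odd p) (h3 : 3 < p) {s : ℕ}
    (hs : p = 6 * s + 5) : legendreSym p 3 = (-1) ^ (s + 1) := by
  have : Fact (Nat.Prime 3) := ⟨Nat.prime_three⟩
  rw [legendreSym_three_eq hp h3, legendreSym.mod 3 (p : ℤ), show p / 2 = 3 * s + 2 by omega,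
    show (p : ℤ) % (3 : ℕ) = 2 by omega, show legendreSym 3 2 = -1 by
      rw [legendreSym.at_two (by norm_num)]; decide, pow_add, pow_mul, pow_succ (-1 : ℤ) s]
  norm_num

theorem legendreSym_six_eq_altSign (hp : Odd p) (h3 : 3 < p) {s : ℕ}
    (hs : p = 6 * s + 1 ∨ p = 6 * s + 5) : legendreSym p 6 = altSign s := by
  have hp2 : p ≠ 2 := by rintro rfl; revert hp; decide
  rw [show (6 : ℤ) = 2 * 3 by norm_num, legendreSym.mul, legendreSym.at_two hp2,
    ZMod.χ₈_nat_eq_if_mod_eight]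
  -- Both sides depend only on s modulo 4, that is, on p modulo 24.
  obtain ⟨r, i, hi, rfl⟩ : ∃ r i, i < 4 ∧ s = 4 * r + i :=
    ⟨s / 4, s % 4, Nat.mod_lt _ (by norm_num), by omega⟩
  rw [altSign_four_mul_add]
  rcases hs with hs | hs
  · rw [legendreSym_three_of_six_mul_add_one hp h3 hs, pow_add, pow_mul]
    interval_cases i <;> simp [altSign] <;> omega
  · rw [legendreSym_three_of_six_mul_add_five hp h3 hs, add_assoc, pow_add, pow_mul]
    interval_cases i <;> simp [altSign] <;> omega

end LegendreSymbols

/-! ### Term ratios of the three sums. -/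

section TermRatios

theorem choose_four_mul_ratio (k : ℕ) :
    (2 * (k : ℚ) + 1) * (2 * k + 2) *
        (((4 * (k + 1)).choose (2 * (k + 1)) : ℚ) / 32 ^ (k + 1))
      = -2 * ((-1 / 4 + k + 1) * (-1 / 4 - k)) * (((4 * k).choose (2 * k) : ℚ) / 32 ^ k) := by
  rw [Nat.cast_choose ℚ (show 2 * (k + 1) ≤ 4 * (k + 1) by omega),
    Nat.cast_choose ℚ (show 2 * k ≤ 4 * k by omega),
    show 4 * (k + 1) - 2 * (k + 1) = 2 * k + 1 + 1 by omega,
    show 4 * k - 2 * k = 2 * k by omega, show 4 * (k + 1) = 4 * k + 1 + 1 + 1 + 1 by ring,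
    show 2 * (k + 1) = 2 * k + 1 + 1 by ring]
  simp only [Nat.factorial_succ]
  push_cast
  field_simp
  ring

theorem choose_three_mul_ratio (k : ℕ) :
    (2 * (k : ℚ) + 1) * (2 * k + 2) * (((3 * (k + 1)).choose (k + 1) : ℚ) * (2 / 27) ^ (k + 1))
      = -2 * ((-1 / 3 + k + 1) * (-1 / 3 - k)) * (((3 * k).choose k : ℚ) * (2 / 27) ^ k) := by
  rw [Nat.cast_choose ℚ (show k + 1 ≤ 3 * (k + 1) by omega),
    Nat.cast_choose ℚ (show k ≤ 3 * k by omega),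
    show 3 * (k + 1) - (k + 1) = 2 * k + 1 + 1 by omega,
    show 3 * k - k = 2 * k by omega, show 3 * (k + 1) = 3 * k + 1 + 1 + 1 by ring]
  simp only [Nat.factorial_succ]
  push_cast
  field_simp
  ring

theorem choose_six_mul_ratio (k : ℕ) :
    (2 * (k : ℚ) + 1) * (2 * k + 2) *
        ((((6 * (k + 1)).choose (3 * (k + 1)) : ℚ) * ((3 * (k + 1)).choose (k + 1) : ℚ)) /
          (216 ^ (k + 1) * ((2 * (k + 1)).choose (k + 1) : ℚ)))
      = -2 * ((-1 / 6 + k + 1) * (-1 / 6 - k)) *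
        ((((6 * k).choose (3 * k) : ℚ) * ((3 * k).choose k : ℚ)) /
          (216 ^ k * ((2 * k).choose k : ℚ))) := by
  rw [Nat.cast_choose ℚ (show 3 * (k + 1) ≤ 6 * (k + 1) by omega),
    Nat.cast_choose ℚ (show k + 1 ≤ 3 * (k + 1) by omega),
    Nat.cast_choose ℚ (show k + 1 ≤ 2 * (k + 1) by omega),
    Nat.cast_choose ℚ (show 3 * k ≤ 6 * k by omega),
    Nat.cast_choose ℚ (show k ≤ 3 * k by omega), Nat.cast_choose ℚ (show k ≤ 2 * k by omega),
    show 6 * (k + 1) - 3 * (k + 1) = 3 * k + 1 + 1 + 1 by omega,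
    show 6 * k - 3 * k = 3 * k by omega, show 3 * (k + 1) - (k + 1) = 2 * k + 1 + 1 by omega,
    show 3 * k - k = 2 * k by omega, show 2 * (k + 1) - (k + 1) = k + 1 by omega,
    show 2 * k - k = k by omega, show 6 * (k + 1) = 6 * k + 1 + 1 + 1 + 1 + 1 + 1 by ring,
    show 3 * (k + 1) = 3 * k + 1 + 1 + 1 by ring, show 2 * (k + 1) = 2 * k + 1 + 1 by ring]
  simp only [Nat.factorial_succ]
  push_cast
  field_simp
  ring

end TermRatios

theorem Padic.norm_ratCast_le_one_of_mul_natCast_eq {p : ℕ} [hpr : Fact p.Prime] {t : ℚ} {d : ℕ}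
    {a : ℤ} (hd : ¬ p ∣ d) (h : t * d = a) : ‖(t : ℚ_[p])‖ ≤ 1 := by
  have hd0 : (d : ℚ) ≠ 0 := Nat.cast_ne_zero.mpr fun h0 => hd (h0 ▸ dvd_zero p)
  apply Padic.norm_rat_le_one
  intro hp
  have h1 : t = Rat.divInt a d := by
    rw [Rat.divInt_eq_div, eq_div_iff (by exact_mod_cast hd0)]
    exact_mod_cast h
  have h2 : (t.den : ℤ) ∣ d := h1 ▸ Rat.den_dvd a d
  exact hd (hp.trans (by exact_mod_cast h2))

/-! ### Specialization to x = -1/d with d = 4, 3, 6. -/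

section Sums

variable {p : ℕ} [hpr : Fact p.Prime]

/-- Here t = -a/d. The choice a = 1 gives t = x and a = d - 1 gives t = -1 - x, the two solutions of
t(t + 1) = x(x + 1). -/
theorem padicModEq_sum_of_mul_eq (hp : Odd p) {n d a : ℕ} (hn : n < p) (hd : ¬ p ∣ d)
    {x : ℚ} (hx : x = n - p * a / d) (hxd : x = -1 / d) (ha : a = 1 ∨ a + 1 = d) {A : ℕ → ℚ}
    (h0 : A 0 = 1)
    (h : ∀ k : ℕ, (2 * k + 1) * (2 * k + 2) * A (k + 1) = -2 * ((x + k + 1) * (x - k)) * A k) :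
    PadicModEq p 2 (∑ k ∈ Finset.range p, A k)
      ((1 - (a : ℚ) / d) * altSign n + (a : ℚ) / d * altSign (p - 1 - n)
        - p * (x * (x + 1)) / 2 * (eulerPoly (p - 2) (-x / 2) + eulerPoly (p - 2) ((x + 1) / 2))) := by
  have hd0 : (d : ℚ) ≠ 0 := Nat.cast_ne_zero.mpr fun h0 => hd (h0 ▸ dvd_zero p)
  have h1 := padicModEq_sum hp hn (x := x) (t := -(a : ℚ) / d)
    (Padic.norm_ratCast_le_one_of_mul_natCast_eq (a := -(a : ℤ)) hd (by push_cast; field_simp))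
    (by rw [hx]; ring) (by
      rw [hxd]
      rcases ha with rfl | rfl
      · push_cast; ring
      · push_cast at hd0 ⊢; field_simp; ring) h0 h
  convert! h1 using 1
  ring

theorem not_dvd_two_pow_mul_three_pow (hp : Odd p) (i j : ℕ) (h : j = 0 ∨ 3 < p) :
    ¬ p ∣ 2 ^ i * 3 ^ j := by
  have hp2 : p ≠ 2 := by rintro rfl; revert hp; decide
  rw [hpr.out.dvd_mul, not_or]
  constructor
  · exact fun h2 => hp2 ((Nat.prime_dvd_prime_iff_eq hpr.out Nat.prime_two).mp
      (hpr.out.dvd_of_dvd_pow h2))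
  · rcases h with rfl | h
    · simpa using hpr.out.one_lt.ne'
    · exact fun h3 => h.ne' ((Nat.prime_dvd_prime_iff_eq hpr.out Nat.prime_three).mp
        (hpr.out.dvd_of_dvd_pow h3))

theorem padicModEq_sum_choose_four_mul (hp : Odd p) {n a : ℕ} (hn : 4 * n + 1 = p * a)
    (ha : a = 1 ∨ a = 3) :
    PadicModEq p 2 (∑ k ∈ Finset.range p, ((4 * k).choose (2 * k) : ℚ) / 32 ^ k)
      (3 / 32 * (p : ℚ) * (eulerPoly (p - 2) (3 / 8) + eulerPoly (p - 2) (1 / 8))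
        + ((1 - (a : ℚ) / 4) * altSign n + (a : ℚ) / 4 * altSign (p - 1 - n))) := by
  have hnq : 4 * (n : ℚ) + 1 = p * a := by exact_mod_cast hn
  have h := padicModEq_sum_of_mul_eq hp (n := n) (d := 4) (a := a) (x := -1 / 4)
    (A := fun k => ((4 * k).choose (2 * k) : ℚ) / 32 ^ k)
    (by rcases ha with rfl | rfl <;> omega)
    (by simpa using not_dvd_two_pow_mul_three_pow hp 2 0 (Or.inl rfl))
    (by push_cast; linear_combination -hnq / 4) (by norm_num) (by omega) (by simp)
    choose_four_mul_ratio
  convert! h using 1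
  norm_num
  ring

theorem padicModEq_sum_choose_three_mul (hp : Odd p) (h3 : 3 < p) {n a : ℕ}
    (hn : 3 * n + 1 = p * a) (ha : a = 1 ∨ a = 2) :
    PadicModEq p 2 (∑ k ∈ Finset.range p, ((3 * k).choose k : ℚ) * (2 / 27) ^ k)
      (((1 - (a : ℚ) / 3) * altSign n + (a : ℚ) / 3 * altSign (p - 1 - n))
        + (p : ℚ) / 9 * (eulerPoly (p - 2) (1 / 3) + eulerPoly (p - 2) (1 / 6))) := by
  have hnq : 3 * (n : ℚ) + 1 = p * a := by exact_mod_cast hn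
  have h := padicModEq_sum_of_mul_eq hp (n := n) (d := 3) (a := a) (x := -1 / 3)
    (A := fun k => ((3 * k).choose k : ℚ) * (2 / 27) ^ k)
    (by rcases ha with rfl | rfl <;> omega)
    (by simpa using not_dvd_two_pow_mul_three_pow hp 0 1 (Or.inr h3))
    (by push_cast; linear_combination -hnq / 3) (by norm_num) (by omega) (by simp)
    choose_three_mul_ratio
  convert! h using 1
  norm_num
  ring

theorem padicModEq_sum_choose_six_mul (hp : Odd p) (h3 : 3 < p) {n a : ℕ}
    (hn : 6 * n + 1 = p * a) (ha : a = 1 ∨ a = 5) :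
    PadicModEq p 2
      (∑ k ∈ Finset.range p,
        (((6 * k).choose (3 * k) : ℚ) * ((3 * k).choose k : ℚ)) /
          (216 ^ k * ((2 * k).choose k : ℚ)))
      (((1 - (a : ℚ) / 6) * altSign n + (a : ℚ) / 6 * altSign (p - 1 - n))
        + 5 * (p : ℚ) / 72 * (eulerPoly (p - 2) (5 / 12) + eulerPoly (p - 2) (1 / 12))) := by
  have hnq : 6 * (n : ℚ) + 1 = p * a := by exact_mod_cast hn
  have h := padicModEq_sum_of_mul_eq hp (n := n) (d := 6) (a := a) (x := -1 / 6)
    (A := fun k => (((6 * k).choose (3 * k) : ℚ) * ((3 * k).choose k : ℚ)) /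
      (216 ^ k * ((2 * k).choose k : ℚ)))
    (by rcases ha with rfl | rfl <;> omega)
    (by simpa using not_dvd_two_pow_mul_three_pow hp 1 1 (Or.inr h3))
    (by push_cast; linear_combination -hnq / 6) (by norm_num) (by omega) (by simp)
    choose_six_mul_ratio
  convert! h using 1
  norm_num
  ring

end Sums

theorem corollary1p4 (p : ℕ) [Fact p.Prime] (hp : Odd p) :
    ((p % 8 = 1 ∨ p % 8 = 7) →
      PadicModEq p 2
        (∑ k ∈ Finset.range p, ((4 * k).choose (2 * k) : ℚ) / 32 ^ k)
        (3 / 32 * (p : ℚ) * (eulerPoly (p - 2) (3 / 8) + eulerPoly (p - 2) (1 / 8))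
          + (legendreSym p (-2) : ℚ) * (-1) ^ (p / 8))) ∧
    ((p % 8 = 3 ∨ p % 8 = 5) →
      PadicModEq p 2
        (∑ k ∈ Finset.range p, ((4 * k).choose (2 * k) : ℚ) / 32 ^ k)
        (3 / 32 * (p : ℚ) * (eulerPoly (p - 2) (3 / 8) + eulerPoly (p - 2) (1 / 8))
          + 1 / 2 * (legendreSym p (-2) : ℚ) * (-1) ^ (p / 8))) ∧
    (3 < p →
      PadicModEq p 2
        (∑ k ∈ Finset.range p, ((3 * k).choose k : ℚ) * (2 / 27) ^ k)
        (1 / 3 + 2 / 3 * (legendreSym p 3 : ℚ)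
          + (p : ℚ) / 9 * (eulerPoly (p - 2) (1 / 3) + eulerPoly (p - 2) (1 / 6))) ∧
      PadicModEq p 2
        (∑ k ∈ Finset.range p,
          (((6 * k).choose (3 * k) : ℚ) * ((3 * k).choose k : ℚ)) /
            (216 ^ k * ((2 * k).choose k : ℚ)))
        ((legendreSym p 6 : ℚ)
          + 5 * (p : ℚ) / 72 * (eulerPoly (p - 2) (5 / 12) + eulerPoly (p - 2) (1 / 12)))) := by
  have hp2 : p ≠ 2 := by rintro rfl; revert hp; decide
  have hpow (r : ℕ) : (-1 : ℚ) ^ (3 * r) = (-1) ^ r := by rw [pow_mul]; norm_num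
  refine ⟨fun h => ?_, fun h => ?_, fun h3 => ?_⟩
  · rw [legendreSym.at_neg_two hp2, ZMod.χ₈'_nat_eq_if_mod_eight]
    obtain ⟨r, hr⟩ : ∃ r, r = p / 8 := ⟨_, rfl⟩
    rcases h with h | h
    -- The multiplier a is p modulo 4, making n = (a p - 1)/4 an integer. For p ≡ ±1 modulo 8 the
    -- two signs agree and their weights add up to 1.
    · convert! padicModEq_sum_choose_four_mul hp (n := 2 * r) (a := 1) (by omega) (by omega) using 2
      rw [show p - 1 - 2 * r = 2 * (3 * r) by omega, altSign_two_mul, altSign_two_mul, ← hr,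
        if_neg (by omega), if_pos (by omega)]
      push_cast
      rw [hpow]
      ring
    · convert! padicModEq_sum_choose_four_mul hp (n := 2 * (3 * r + 2) + 1) (a := 3) (by omega)
        (by omega) using 2
      rw [show p - 1 - (2 * (3 * r + 2) + 1) = 2 * r + 1 by omega, altSign_two_mul_add_one,
        altSign_two_mul_add_one, ← hr, if_neg (by omega), if_neg (by omega)]
      simp only [pow_succ]
      push_cast
      simp only [hpow]
      ring
  · rw [legendreSym.at_neg_two hp2, ZMod.χ₈'_nat_eq_if_mod_eight]
    obtain ⟨r, hr⟩ : ∃ r, r = p / 8 := ⟨_, rfl⟩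
    rcases h with h | h
    -- For p ≡ ±3 modulo 8 the signs are opposite, and the weights 1/4 and 3/4 leave a half.
    · convert! padicModEq_sum_choose_four_mul hp (n := 2 * (3 * r + 1)) (a := 3) (by omega)
        (by omega) using 2
      rw [show p - 1 - 2 * (3 * r + 1) = 2 * r by omega, altSign_two_mul, altSign_two_mul, ← hr,
        if_neg (by omega), if_pos (by omega)]
      push_cast
      simp only [pow_succ, hpow]
      ring
    · convert! padicModEq_sum_choose_four_mul hp (n := 2 * r + 1) (a := 1) (by omega)
        (by omega) using 2
      rw [show p - 1 - (2 * r + 1) = 2 * (3 * r + 1) + 1 by omega, altSign_two_mul_add_one,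
        altSign_two_mul_add_one, ← hr, if_neg (by omega), if_neg (by omega)]
      push_cast
      simp only [pow_succ, hpow]
      ring
  · have hmod : p % 6 = 1 ∨ p % 6 = 5 := by
      have h0 : p % 3 ≠ 0 := fun h0 => by
        simpa using not_dvd_two_pow_mul_three_pow hp 0 1 (Or.inr h3)
          (by simp [(Nat.prime_dvd_prime_iff_eq Nat.prime_three Fact.out).mp
            (Nat.dvd_of_mod_eq_zero h0)])
      obtain ⟨k, hk⟩ := hp
      omega
    obtain ⟨s, hs⟩ : ∃ s, s = p / 6 := ⟨_, rfl⟩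
    rcases hmod with hmod | hmod
    · constructor
      · convert! padicModEq_sum_choose_three_mul hp h3 (n := 2 * s) (a := 1) (by omega) (by omega)
          using 2
        -- The index 4s has sign 1 and weight 1/3, the source of the constant; the other sign is the
        -- Legendre symbol of 3.
        rw [show p - 1 - 2 * s = 4 * s + 0 by omega, altSign_four_mul_add, altSign_zero,
          altSign_two_mul, legendreSym_three_of_six_mul_add_one hp h3 (s := s) (by omega)]
        push_cast
        ring
      · convert! padicModEq_sum_choose_six_mul hp h3 (n := s) (a := 1) (by omega) (by omega)
          using 2
        -- The indices agree modulo 4, so the weights again add up to 1.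
        rw [show p - 1 - s = 4 * s + s by omega, altSign_four_mul_add,
          legendreSym_six_eq_altSign hp h3 (s := s) (by omega)]
        push_cast
        ring
    · constructor
      · convert! padicModEq_sum_choose_three_mul hp h3 (n := 4 * s + 3) (a := 2) (by omega)
          (by omega) using 2
        rw [show p - 1 - (4 * s + 3) = 2 * s + 1 by omega, altSign_four_mul_add,
          show altSign 3 = 1 from rfl, altSign_two_mul_add_one,
          legendreSym_three_of_six_mul_add_five hp h3 (s := s) (by omega)]
        push_cast
        ring
      · convert! padicModEq_sum_choose_six_mul hp h3 (n := 4 * (s + 1) + s) (a := 5) (by omega)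
          (by omega) using 2
        rw [show p - 1 - (4 * (s + 1) + s) = s by omega, altSign_four_mul_add,
          legendreSym_six_eq_altSign hp h3 (s := s) (by omega)]
        push_cast
        ring
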